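/- **Theorem (separability).** Let $\mathbb T\subset\mathbb R$ be a closed set (a time scale), $a,b\in\mathbb T$ with $a<b$, $J=[a,b]\cap\mathbb T$, $N\in\mathbb N$, $0<\alpha\le 1$ and $1\le p<\infty$. Let $\sigma(t)=\inf\{s\in\mathbb T:s>t\}$ be the forward jump operator, let $f^\Delta$ denote the delta derivative on $J$, let $\Delta t$ denote the Lebesgue $\Delta$-measure on $[a,b)\cap\mathbb T$ (Lebesgue measure plus a mass $\sigma(t)-t$ at every right-scattered $t$), and let $L^p_\Delta=L^p_\Delta([a,b)\cap\mathbb T,\mathbb R^N)$. For $0<\beta<1$ put $$ {}_aI_t^{\beta}h(t)=\int_a^t\frac{(t-\sigma(s))^{\beta-1}}{\Gamma(\beta)}h(s)\,\Delta s,\qquad {}_tI_b^{\beta}h(t)=\int_t^b\frac{(s-\sigma(t))^{\beta-1}}{\Gamma(\beta)}h(s)\,\Delta s, $$ where $x^{\beta-1}$ is read as $0$ for $x\le 0$, and let both operators be the identity for $\beta=0$. Let ${}_aD_t^\alpha\varphi=({}_aI_t^{1-\alpha}\varphi)^\Delta$ be the left Riemann–Liouville derivative. Say that $g$ is a right Riemann–Liouville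 derivative ${}_tD_b^\alpha u=-({}_tI_b^{1-\alpha}u)^\Delta$ of $u$ if ${}_tI_b^{1-\alpha}u$ agrees $\Delta$-a.e. with an absolutely continuous function on $J$ whose delta derivative is $-g$ $\Delta$-a.e. Let $C^\infty_{c,rd}$ be the set of functions $\varphi:J\to\mathbb R^N$ that have rd-continuous delta derivatives of all orders and compact support in $(a,b)\cap\mathbb T$. The right fractional Sobolev space $W^{\alpha,p}_{\Delta,b^-}$ is the set of all $u\in L^p_\Delta$ for which there is a $g\in L^p_\Delta$, called a weak right fractional derivative of $u$, with $$\int_a^b u(t)\cdot{}_aD_t^\alpha\varphi(t)\,\Delta t=\int_a^b g(t)\cdot\varphi(t)\,\Delta t$$ (both integrals converging) for all $\varphi\in C^\infty_{c,rd}$ for which ${}_aI_t^{1-\alpha}\varphi$ exists on $J$ and ${}_aD_t^\alpha\varphi$ exists $\Delta$-a.e. 1. $W^{\alpha,p}_{\Delta,b^-}$ is separable with respect to the norm $\|u\|=\big(\|u\|_{L^p_\Delta}^p+\|g\|_{L^p_\Delta}^p\big)^{1/p}$, where $g$ is the weak right fractional derivative of $u$. 2. The space of those $u\in W^{\alpha,p}_{\Delta,b^-}$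 that have a right Riemann–Liouville derivative ${}_tD_b^\alpha u\in L^p_\Delta$ is separable with respect to the norm $\|u\|=\big(\|u\|_{L^p_\Delta}^p+\|{}_tD_b^\alpha u\|_{L^p_\Delta}^p\big)^{1/p}$. If $u$ has more than one derivative of the kind in question in $L^p_\Delta$ (as can happen when an end point of $J$ is isolated), the norm is understood as the infimum over all of them. -/

import Mathlib

open MeasureTheory Set Filter Topology
open scoped ENNReal

noncomputable section

namespace TimeScale

/-- The part `[a, b] ∩ 𝕋` of the time scale `𝕋`. -/
def interval (T : Set ℝ) (a b : ℝ) : Set ℝ := T ∩ Icc a b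

open Classical in
/-- The forward jump operator `σ(t) = inf {s ∈ S : s > t}` of a time scale `S`, with `σ(t) = t` if
no such `s` exists. -/
def sigma (S : Set ℝ) (t : ℝ) : ℝ :=
  if (S ∩ Ioi t).Nonempty then sInf (S ∩ Ioi t) else t

/-- The Lebesgue `Δ`-measure of `[a, b) ∩ 𝕋`, as a measure on `ℝ`: Lebesgue measure on that set,
plus a point mass `σ(t) - t` at each right-scattered point `t` of it. -/
def deltaMeasure (T : Set ℝ) (a b : ℝ) : Measure ℝ :=
  volume.restrict (T ∩ Ico a b) +
    Measure.sum fun t : {t : ℝ // t ∈ T ∩ Ico a b ∧ t < sigma T t} =>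
      ENNReal.ofReal (sigma T t.1 - t.1) • Measure.dirac t.1

variable {E : Type*} [NormedAddCommGroup E] [NormedSpace ℝ E]

/-- `f' = f^Δ(t)`: the delta (Hilger) derivative at `t` of `f`, on the time scale `S`. -/
def HasDeltaDerivAt (S : Set ℝ) (f : ℝ → E) (f' : E) (t : ℝ) : Prop :=
  ∀ ε > 0, ∃ δ > 0, ∀ s ∈ S, |s - t| < δ →
    ‖f (sigma S t) - f s - (sigma S t - s) • f'‖ ≤ ε * |sigma S t - s|

/-- rd-continuity on `S`: continuity at right-dense points, finite left-sided limits at left-dense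
points. -/
def RdContinuousOn (S : Set ℝ) (f : ℝ → E) : Prop :=
  (∀ t ∈ S, (S ∩ Ioi t).Nonempty → sigma S t = t → ContinuousWithinAt f S t) ∧
    ∀ t ∈ S, t ∈ closure (S ∩ Iio t) → ∃ l, Tendsto f (𝓝[S ∩ Iio t] t) (𝓝 l)

/-- Absolute continuity on the time scale `S`. -/
def AbsContOn (S : Set ℝ) (f : ℝ → E) : Prop :=
  ∀ ε > 0, ∃ δ > 0, ∀ (n : ℕ) (c d : Fin n → ℝ),
    (∀ i, c i ∈ S ∧ d i ∈ S ∧ c i ≤ d i) →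
    (Pairwise fun i j => Disjoint (Ico (c i) (d i)) (Ico (c j) (d j))) →
    ∑ i, (d i - c i) < δ → ∑ i, ‖f (d i) - f (c i)‖ < ε

/-- The class `C_{c,rd}^∞`: functions on `[a, b] ∩ 𝕋` having delta derivatives of all orders, all of
them rd-continuous, with compact support in `(a, b) ∩ 𝕋`. -/
def IsTestFunction (T : Set ℝ) (a b : ℝ) (φ : ℝ → E) : Prop :=
  (∃ Φ : ℕ → ℝ → E, Φ 0 = φ ∧ ∀ n, RdContinuousOn (interval T a b) (Φ n) ∧
      ∀ t ∈ interval T a b, HasDeltaDerivAt (interval T a b) (Φ n) (Φ (n + 1) t) t) ∧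
    ∃ c d, a < c ∧ d < b ∧ ∀ t ∈ interval T a b, t ∉ Icc c d → φ t = 0

/-- The kernel `x^(β-1) / Γ(β)`, understood as `0` for `x ≤ 0` if `β ≠ 1` and as `1` if `β = 1`. -/
def fracKernel (β x : ℝ) : ℝ := (max x 0) ^ (β - 1) / Real.Gamma β

/-- The left fractional integral of order `β` of `h`, at `t`, exists and equals `y`; here
`I^β h(t) = ∫_a^t (t - σ(s))^(β-1) / Γ(β) h(s) Δs` for `β > 0`, and `I^0 h = h`. -/
def HasLeftFracInt (T : Set ℝ) (a b β : ℝ) (h : ℝ → E) (t : ℝ) (y : E) : Prop :=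
  (β = 0 ∧ y = h t) ∨
  (β ≠ 0 ∧ IntegrableOn (fun s => fracKernel β (t - sigma T s) • h s) (Ico a t)
      (deltaMeasure T a b) ∧
    y = ∫ s in Ico a t, fracKernel β (t - sigma T s) • h s ∂(deltaMeasure T a b))

/-- The right fractional integral of order `β` of `h`, at `t`, exists and equals `y`; here
`I^β h(t) = ∫_t^b (s - σ(t))^(β-1) / Γ(β) h(s) Δs` for `β > 0`, and `I^0 h = h`. -/
def HasRightFracInt (T : Set ℝ) (a b β : ℝ) (h : ℝ → E) (t : ℝ) (y : E) : Prop :=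
  (β = 0 ∧ y = h t) ∨
  (β ≠ 0 ∧ IntegrableOn (fun s => fracKernel β (s - sigma T t) • h s) (Ico t b)
      (deltaMeasure T a b) ∧
    y = ∫ s in Ico t b, fracKernel β (s - sigma T t) • h s ∂(deltaMeasure T a b))

/-- `v` is the left Riemann-Liouville derivative `(I^(1-α) φ)^Δ` of `φ`, `Δ`-a.e. -/
def HasLeftRLDeriv (T : Set ℝ) (a b α : ℝ) (φ v : ℝ → E) : Prop :=
  ∃ F : ℝ → E, (∀ t ∈ interval T a b, HasLeftFracInt T a b (1 - α) φ t (F t)) ∧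
    ∀ᵐ t ∂(deltaMeasure T a b), HasDeltaDerivAt (interval T a b) F (v t) t

/-- `g` is a right Riemann-Liouville derivative of `u`: the right fractional integral `I^(1-α) u`
agrees `Δ`-a.e. with an absolutely continuous function, whose delta derivative is `-g`,
`Δ`-a.e. -/
def HasRightRLDeriv (T : Set ℝ) (a b α : ℝ) (u g : ℝ → E) : Prop :=
  ∃ F : ℝ → E, AbsContOn (interval T a b) F ∧
    (∀ᵐ t ∂(deltaMeasure T a b), HasRightFracInt T a b (1 - α) u t (F t)) ∧
    ∀ᵐ t ∂(deltaMeasure T a b), HasDeltaDerivAt (interval T a b) F (-g t) t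

/-- `g` is a weak right fractional derivative of order `α` of `u`:
`∫ u · D^α φ Δt = ∫ g · φ Δt` for all test functions `φ`, where `D^α` is the left
Riemann-Liouville derivative. -/
def IsWeakRightDeriv (T : Set ℝ) (a b : ℝ) {N : ℕ} (α : ℝ)
    (u g : ℝ → EuclideanSpace ℝ (Fin N)) : Prop :=
  ∀ φ v : ℝ → EuclideanSpace ℝ (Fin N), IsTestFunction T a b φ → HasLeftRLDeriv T a b α φ v →
    Integrable (fun t => inner ℝ (u t) (v t)) (deltaMeasure T a b) ∧
    Integrable (fun t => inner ℝ (g t) (φ t)) (deltaMeasure T a b) ∧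
    ∫ t, inner ℝ (u t) (v t) ∂(deltaMeasure T a b) =
      ∫ t, inner ℝ (g t) (φ t) ∂(deltaMeasure T a b)

/-! ### Linearity -/

theorem HasDeltaDerivAt.add {S : Set ℝ} {f g : ℝ → E} {f' g' : E} {t : ℝ}
    (hf : HasDeltaDerivAt S f f' t) (hg : HasDeltaDerivAt S g g' t) :
    HasDeltaDerivAt S (f + g) (f' + g') t := by
  intro ε hε
  obtain ⟨δ₁, h₁, H₁⟩ := hf (ε / 2) (half_pos hε)
  obtain ⟨δ₂, h₂, H₂⟩ := hg (ε / 2) (half_pos hε)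
  refine ⟨min δ₁ δ₂, lt_min h₁ h₂, fun s hs hst => ?_⟩
  have A := H₁ s hs (hst.trans_le (min_le_left _ _))
  have B := H₂ s hs (hst.trans_le (min_le_right _ _))
  have e : (f + g) (sigma S t) - (f + g) s - (sigma S t - s) • (f' + g') =
      (f (sigma S t) - f s - (sigma S t - s) • f') +
        (g (sigma S t) - g s - (sigma S t - s) • g') := by
    simp only [Pi.add_apply, smul_add]; abel
  rw [e]
  refine (norm_add_le _ _).trans ?_
  linarith

theorem HasDeltaDerivAt.const_smul {S : Set ℝ} {f : ℝ → E} {f' : E} {t : ℝ} (c : ℝ)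
    (hf : HasDeltaDerivAt S f f' t) : HasDeltaDerivAt S (c • f) (c • f') t := by
  intro ε hε
  have hc : 0 < |c| + 1 := by positivity
  obtain ⟨δ, h, H⟩ := hf (ε / (|c| + 1)) (div_pos hε hc)
  refine ⟨δ, h, fun s hs hst => ?_⟩
  have A := H s hs hst
  have e : (c • f) (sigma S t) - (c • f) s - (sigma S t - s) • (c • f') =
      c • (f (sigma S t) - f s - (sigma S t - s) • f') := by
    simp only [Pi.smul_apply, smul_sub, smul_comm c]
  rw [e, norm_smul, Real.norm_eq_abs]
  calc |c| * ‖f (sigma S t) - f s - (sigma S t - s) • f'‖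
      ≤ (|c| + 1) * (ε / (|c| + 1) * |sigma S t - s|) := by
        gcongr
        linarith
    _ = ε * |sigma S t - s| := by field_simp

theorem AbsContOn.add {E : Type*} [NormedAddCommGroup E] {S : Set ℝ} {f g : ℝ → E}
    (hf : AbsContOn S f) (hg : AbsContOn S g) : AbsContOn S (f + g) := by
  intro ε hε
  obtain ⟨δ₁, h₁, H₁⟩ := hf (ε / 2) (half_pos hε)
  obtain ⟨δ₂, h₂, H₂⟩ := hg (ε / 2) (half_pos hε)
  refine ⟨min δ₁ δ₂, lt_min h₁ h₂, fun n c d hcd hdis hs => ?_⟩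
  have A := H₁ n c d hcd hdis (hs.trans_le (min_le_left _ _))
  have B := H₂ n c d hcd hdis (hs.trans_le (min_le_right _ _))
  have C : ∑ i, ‖(f + g) (d i) - (f + g) (c i)‖ ≤
      ∑ i, ‖f (d i) - f (c i)‖ + ∑ i, ‖g (d i) - g (c i)‖ := by
    rw [← Finset.sum_add_distrib]
    refine Finset.sum_le_sum fun i _ => ?_
    simp only [Pi.add_apply, add_sub_add_comm]
    exact norm_add_le _ _
  linarith

theorem AbsContOn.const_smul {S : Set ℝ} {f : ℝ → E} (k : ℝ) (hf : AbsContOn S f) :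
    AbsContOn S (k • f) := by
  intro ε hε
  have hc : 0 < |k| + 1 := by positivity
  obtain ⟨δ, h, H⟩ := hf (ε / (|k| + 1)) (div_pos hε hc)
  refine ⟨δ, h, fun n c d hcd hdis hs => ?_⟩
  have A := H n c d hcd hdis hs
  have e : ∑ i, ‖(k • f) (d i) - (k • f) (c i)‖ = |k| * ∑ i, ‖f (d i) - f (c i)‖ := by
    rw [Finset.mul_sum]
    refine Finset.sum_congr rfl fun i _ => ?_
    rw [Pi.smul_apply, Pi.smul_apply, ← smul_sub, norm_smul, Real.norm_eq_abs]
  rw [e]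
  rw [lt_div_iff₀ hc] at A
  have : 0 ≤ ∑ i, ‖f (d i) - f (c i)‖ := Finset.sum_nonneg fun i _ => norm_nonneg _
  nlinarith

theorem HasRightFracInt.add {T : Set ℝ} {a b β : ℝ} {h k : ℝ → E} {t : ℝ} {y z : E}
    (hy : HasRightFracInt T a b β h t y) (hz : HasRightFracInt T a b β k t z) :
    HasRightFracInt T a b β (h + k) t (y + z) := by
  rcases hy with ⟨h0, rfl⟩ | ⟨h0, hi, rfl⟩ <;> rcases hz with ⟨h1, rfl⟩ | ⟨h1, hj, rfl⟩
  · exact Or.inl ⟨h0, rfl⟩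
  · exact absurd h0 h1
  · exact absurd h1 h0
  · refine Or.inr ⟨h0, ?_, ?_⟩
    · simp only [Pi.add_apply, smul_add]
      exact Integrable.add hi hj
    · simp only [Pi.add_apply, smul_add]
      exact (integral_add hi hj).symm

theorem HasRightFracInt.const_smul {T : Set ℝ} {a b β : ℝ} {h : ℝ → E} {t : ℝ} {y : E} (c : ℝ)
    (hy : HasRightFracInt T a b β h t y) : HasRightFracInt T a b β (c • h) t (c • y) := by
  rcases hy with ⟨h0, rfl⟩ | ⟨h0, hi, rfl⟩
  · exact Or.inl ⟨h0, rfl⟩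
  · refine Or.inr ⟨h0, ?_, ?_⟩
    · simp only [Pi.smul_apply, smul_comm _ c]
      exact Integrable.smul c hi
    · simp only [Pi.smul_apply, smul_comm _ c]
      exact (integral_smul c _).symm

theorem HasRightFracInt.congr {T : Set ℝ} {a b β : ℝ} {h k : ℝ → E} {t : ℝ} {y : E}
    (hy : HasRightFracInt T a b β h t y) (ht : h t = k t) (hk : h =ᵐ[deltaMeasure T a b] k) :
    HasRightFracInt T a b β k t y := by
  have e : (fun s => fracKernel β (s - sigma T t) • h s)
      =ᵐ[(deltaMeasure T a b).restrict (Ico t b)]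
      fun s => fracKernel β (s - sigma T t) • k s := by
    filter_upwards [ae_restrict_of_ae hk] with s hs
    rw [hs]
  rcases hy with ⟨h0, rfl⟩ | ⟨h0, hi, rfl⟩
  · exact Or.inl ⟨h0, ht⟩
  · exact Or.inr ⟨h0, hi.congr e, integral_congr_ae e⟩

theorem HasRightRLDeriv.congr {T : Set ℝ} {a b α : ℝ} {u v g h : ℝ → E}
    (H : HasRightRLDeriv T a b α u g) (huv : u =ᵐ[deltaMeasure T a b] v)
    (hgh : g =ᵐ[deltaMeasure T a b] h) : HasRightRLDeriv T a b α v h := by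
  obtain ⟨F, hF, hI, hD⟩ := H
  refine ⟨F, hF, ?_, ?_⟩
  · filter_upwards [hI, huv] with t ht h2 using ht.congr h2 huv
  · filter_upwards [hD, hgh] with t ht h2
    rwa [← h2]

theorem HasRightRLDeriv.add {T : Set ℝ} {a b α : ℝ} {u v g h : ℝ → E}
    (H : HasRightRLDeriv T a b α u g) (K : HasRightRLDeriv T a b α v h) :
    HasRightRLDeriv T a b α (u + v) (g + h) := by
  obtain ⟨F, hF, hI, hD⟩ := H
  obtain ⟨G, hG, hJ, hE⟩ := K
  refine ⟨F + G, hF.add hG, ?_, ?_⟩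
  · filter_upwards [hI, hJ] with t h1 h2 using h1.add h2
  · filter_upwards [hD, hE] with t h1 h2
    have := h1.add h2
    rwa [← neg_add] at this

theorem HasRightRLDeriv.const_smul {T : Set ℝ} {a b α : ℝ} {u g : ℝ → E} (c : ℝ)
    (H : HasRightRLDeriv T a b α u g) : HasRightRLDeriv T a b α (c • u) (c • g) := by
  obtain ⟨F, hF, hI, hD⟩ := H
  refine ⟨c • F, hF.const_smul c, ?_, ?_⟩
  · filter_upwards [hI] with t h1 using h1.const_smul c
  · filter_upwards [hD] with t h1
    have := h1.const_smul c
    rwa [smul_neg] at this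

theorem hasRightRLDeriv_zero (T : Set ℝ) (a b α : ℝ) :
    HasRightRLDeriv T a b α (0 : ℝ → E) 0 := by
  refine ⟨0, ?_, ?_, ?_⟩
  · intro ε hε
    exact ⟨1, one_pos, fun n c d _ _ _ => by simpa using hε⟩
  · refine Eventually.of_forall fun t => ?_
    rcases eq_or_ne (1 - α) 0 with h | h
    · exact Or.inl ⟨h, rfl⟩
    · exact Or.inr ⟨h, by simp, by simp⟩
  · refine Eventually.of_forall fun t ε hε => ⟨1, one_pos, fun s _ _ => ?_⟩
    simp only [Pi.zero_apply, sub_self, neg_zero, smul_zero, norm_zero]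
    positivity

theorem IsWeakRightDeriv.congr {T : Set ℝ} {a b α : ℝ} {N : ℕ}
    {u v g h : ℝ → EuclideanSpace ℝ (Fin N)} (H : IsWeakRightDeriv T a b α u g)
    (huv : u =ᵐ[deltaMeasure T a b] v) (hgh : g =ᵐ[deltaMeasure T a b] h) :
    IsWeakRightDeriv T a b α v h := by
  intro φ w hφ hw
  obtain ⟨h1, h2, h3⟩ := H φ w hφ hw
  have e1 : (fun t => inner ℝ (u t) (w t)) =ᵐ[deltaMeasure T a b]
      fun t => inner ℝ (v t) (w t) := by
    filter_upwards [huv] with t ht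
    rw [ht]
  have e2 : (fun t => inner ℝ (g t) (φ t)) =ᵐ[deltaMeasure T a b]
      fun t => inner ℝ (h t) (φ t) := by
    filter_upwards [hgh] with t ht
    rw [ht]
  exact ⟨h1.congr e1, h2.congr e2, by rw [← integral_congr_ae e1, ← integral_congr_ae e2, h3]⟩

theorem IsWeakRightDeriv.add {T : Set ℝ} {a b α : ℝ} {N : ℕ}
    {u v g h : ℝ → EuclideanSpace ℝ (Fin N)} (H : IsWeakRightDeriv T a b α u g)
    (K : IsWeakRightDeriv T a b α v h) : IsWeakRightDeriv T a b α (u + v) (g + h) := by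
  intro φ w hφ hw
  obtain ⟨h1, h2, h3⟩ := H φ w hφ hw
  obtain ⟨k1, k2, k3⟩ := K φ w hφ hw
  simp only [Pi.add_apply, inner_add_left]
  exact ⟨h1.add k1, h2.add k2, by rw [integral_add h1 k1, integral_add h2 k2, h3, k3]⟩

theorem IsWeakRightDeriv.const_smul {T : Set ℝ} {a b α : ℝ} {N : ℕ}
    {u g : ℝ → EuclideanSpace ℝ (Fin N)} (c : ℝ) (H : IsWeakRightDeriv T a b α u g) :
    IsWeakRightDeriv T a b α (c • u) (c • g) := by
  intro φ w hφ hw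
  obtain ⟨h1, h2, h3⟩ := H φ w hφ hw
  simp only [Pi.smul_apply, real_inner_smul_left]
  exact ⟨h1.const_mul c, h2.const_mul c, by rw [integral_const_mul, integral_const_mul, h3]⟩

/-! ### The spaces -/

/-- `L^p_Δ([a, b) ∩ 𝕋, ℝ^N)`. -/
abbrev DeltaLp (T : Set ℝ) (a b : ℝ) (N : ℕ) (p : ℝ≥0∞) : Type :=
  Lp (EuclideanSpace ℝ (Fin N)) p (deltaMeasure T a b)

/-- All pairs `(u, g)` in `L^p_Δ` with `g` a weak right fractional derivative of `u`. -/
def weakGraph (T : Set ℝ) (a b : ℝ) (N : ℕ) (α : ℝ) (p : ℝ≥0∞) [Fact (1 ≤ p)] :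
    Submodule ℝ (DeltaLp T a b N p × DeltaLp T a b N p) where
  carrier := {x | IsWeakRightDeriv T a b α x.1 x.2}
  add_mem' {x y} hx hy :=
    (IsWeakRightDeriv.add hx hy).congr (Lp.coeFn_add x.1 y.1).symm (Lp.coeFn_add x.2 y.2).symm
  zero_mem' := by
    have h : IsWeakRightDeriv T a b α (0 : ℝ → EuclideanSpace ℝ (Fin N)) 0 := by
      intro φ w _ _
      simp
    exact h.congr (Lp.coeFn_zero _ _ _).symm (Lp.coeFn_zero _ _ _).symm
  smul_mem' c x hx :=
    (IsWeakRightDeriv.const_smul c hx).congr (Lp.coeFn_smul c x.1).symm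
      (Lp.coeFn_smul c x.2).symm

/-- All pairs `(u, g)` in `L^p_Δ` with `g` a right Riemann-Liouville derivative of `u`, where `u` has
some weak right fractional derivative in `L^p_Δ`. -/
def rlGraph (T : Set ℝ) (a b : ℝ) (N : ℕ) (α : ℝ) (p : ℝ≥0∞) [Fact (1 ≤ p)] :
    Submodule ℝ (DeltaLp T a b N p × DeltaLp T a b N p) where
  carrier := {x | x.1 ∈ (weakGraph T a b N α p).map (LinearMap.fst ℝ _ _) ∧
    HasRightRLDeriv T a b α x.1 x.2}
  add_mem' {x y} hx hy := ⟨Submodule.add_mem _ hx.1 hy.1,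
    (hx.2.add hy.2).congr (Lp.coeFn_add x.1 y.1).symm (Lp.coeFn_add x.2 y.2).symm⟩
  zero_mem' := ⟨Submodule.zero_mem _, (hasRightRLDeriv_zero T a b α).congr
    (Lp.coeFn_zero _ _ _).symm (Lp.coeFn_zero _ _ _).symm⟩
  smul_mem' c x hx := ⟨Submodule.smul_mem _ c hx.1,
    (hx.2.const_smul c).congr (Lp.coeFn_smul c x.1).symm (Lp.coeFn_smul c x.2).symm⟩

section Domain

variable {X : Type*} [NormedAddCommGroup X] [NormedSpace ℝ X]

/-- The space of all `u` that have a derivative `g`, for the notion of derivative whose graph is `G`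
(the set of pairs `(u, g)` with `g` a derivative of `u`). It is normed, below, by
`(‖u‖^p + ‖g‖^p)^(1/p)`, where the infimum over `g` is taken if `u` has several derivatives. -/
def Domain (_p : ℝ≥0∞) (G : Submodule ℝ (X × X)) : Type _ := ↥(G.map (LinearMap.fst ℝ X X))

variable {p : ℝ≥0∞} {G : Submodule ℝ (X × X)}

/-- The underlying element of `X`. -/
def Domain.val (u : Domain p G) : X := Subtype.val u

/-- The set of derivatives of `u`. -/
def Domain.derivs (u : Domain p G) : Set X := {g | (u.val, g) ∈ G}

instance : AddCommGroup (Domain p G) :=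
  inferInstanceAs (AddCommGroup ↥(G.map (LinearMap.fst ℝ X X)))

instance : Module ℝ (Domain p G) :=
  inferInstanceAs (Module ℝ ↥(G.map (LinearMap.fst ℝ X X)))

theorem Domain.val_zero : (0 : Domain p G).val = 0 := rfl

theorem Domain.val_add (u v : Domain p G) : (u + v).val = u.val + v.val := rfl

theorem Domain.val_neg (u : Domain p G) : (-u).val = -u.val := rfl

theorem Domain.val_injective : Function.Injective (Domain.val : Domain p G → X) :=
  Subtype.val_injective

theorem Domain.derivs_nonempty (u : Domain p G) : u.derivs.Nonempty := by
  obtain ⟨⟨x, g⟩, hx, hxu⟩ := (Submodule.mem_map).1 (Subtype.property u)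
  refine ⟨g, ?_⟩
  have : x = u.val := hxu
  rw [Domain.derivs, mem_ofPred_eq, ← this]
  exact hx

/-- `inf {(‖u‖^p + ‖g‖^p)^(1/p) : g a derivative of u}`; see `Domain.graphNorm_eq`. -/
def Domain.graphNorm (u : Domain p G) : ℝ :=
  sInf ((fun g : X => ‖WithLp.toLp p (u.val, g)‖) '' u.derivs)

theorem Domain.le_graphNorm (u : Domain p G) {r : ℝ}
    (h : ∀ g ∈ u.derivs, r ≤ ‖WithLp.toLp p (u.val, g)‖) : r ≤ u.graphNorm :=
  le_csInf (u.derivs_nonempty.image _) (by rintro _ ⟨g, hg, rfl⟩; exact h g hg)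

variable [Fact (1 ≤ p)]

theorem Domain.graphNorm_le (u : Domain p G) {g : X} (hg : g ∈ u.derivs) :
    u.graphNorm ≤ ‖WithLp.toLp p (u.val, g)‖ :=
  csInf_le ⟨0, by rintro _ ⟨g, _, rfl⟩; exact norm_nonneg _⟩ ⟨g, hg, rfl⟩

/-- If `g` is the only derivative of `u`, the norm of `u` is `(‖u‖^p + ‖g‖^p)^(1/p)`. -/
theorem Domain.graphNorm_eq (hp : p ≠ ∞) (u : Domain p G) {g : X} (hg : u.derivs = {g}) :
    u.graphNorm = (‖u.val‖ ^ p.toReal + ‖g‖ ^ p.toReal) ^ (1 / p.toReal) := by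
  have h1 : (1 : ℝ≥0∞) ≤ p := Fact.out
  have h0 : 0 < p.toReal := ENNReal.toReal_pos (zero_lt_one.trans_le h1).ne' hp
  rw [Domain.graphNorm, hg, image_singleton, csInf_singleton, WithLp.prod_norm_eq_add h0]
  rfl

theorem Domain.norm_val_le (u : Domain p G) : ‖u.val‖ ≤ u.graphNorm :=
  u.le_graphNorm fun g _ => WithLp.norm_fst_le _ (WithLp.toLp p (u.val, g))

instance : NormedAddCommGroup (Domain p G) :=
  AddGroupNorm.toNormedAddCommGroup
    { toFun := Domain.graphNorm
      map_zero' := by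
        refine le_antisymm ?_ ((norm_nonneg (0 : Domain p G).val).trans (Domain.norm_val_le _))
        have h : (0 : X) ∈ (0 : Domain p G).derivs := G.zero_mem
        refine (Domain.graphNorm_le _ h).trans (le_of_eq ?_)
        rw [Domain.val_zero]
        exact norm_zero
      add_le' := fun u v => by
        rw [← sub_le_iff_le_add]
        refine u.le_graphNorm fun g hg => ?_
        rw [sub_le_comm]
        refine v.le_graphNorm fun h hh => ?_
        rw [sub_le_iff_le_add']
        have hm : g + h ∈ (u + v).derivs := G.add_mem hg hh
        refine (Domain.graphNorm_le _ hm).trans ?_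
        exact norm_add_le (WithLp.toLp p (u.val, g)) (WithLp.toLp p (v.val, h))
      neg' := by
        have key : ∀ u : Domain p G, (-u).graphNorm ≤ u.graphNorm := fun u => by
          refine u.le_graphNorm fun g hg => ?_
          have hm : -g ∈ (-u).derivs := G.neg_mem hg
          refine (Domain.graphNorm_le _ hm).trans (le_of_eq ?_)
          exact norm_neg (WithLp.toLp p (u.val, g))
        intro u
        exact le_antisymm (key u) (by simpa using key (-u))
      eq_zero_of_map_eq_zero' := fun u hu => by
        have h : ‖u.val‖ ≤ 0 := (Domain.norm_val_le u).trans hu.le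
        exact Domain.val_injective (norm_le_zero_iff.1 h) }

end Domain

/-- The right fractional Sobolev space `W^{α,p}_{Δ,b⁻}([a, b] ∩ 𝕋, ℝ^N)`: all `u ∈ L^p_Δ` having a
weak right fractional derivative `g ∈ L^p_Δ`, with the norm `(‖u‖^p + ‖g‖^p)^(1/p)`. -/
abbrev RightSobolev (T : Set ℝ) (a b : ℝ) (N : ℕ) (α : ℝ) (p : ℝ≥0∞) [Fact (1 ≤ p)] :
    Type :=
  Domain p (weakGraph T a b N α p)

/-- The elements `u` of the right fractional Sobolev space whose right Riemann-Liouville derivative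
`D^α u` exists and lies in `L^p_Δ`, with the norm `(‖u‖^p + ‖D^α u‖^p)^(1/p)`. -/
abbrev RightSobolevRL (T : Set ℝ) (a b : ℝ) (N : ℕ) (α : ℝ) (p : ℝ≥0∞) [Fact (1 ≤ p)] :
    Type :=
  Domain p (rlGraph T a b N α p)

end TimeScale

end

namespace TimeScale

/-! Separability uses nothing about fractional derivatives beyond linearity of the relation "`g` is
a derivative of `u`". The pairs `(u, g)` form a subspace `G` of `L^p × L^p`, and each space is the
projection of such a `G` to the first factor, normed by the infimum of the `p`-product norm over the
fibre. So the projection is a surjective contraction from `G`, and a continuous image of a separable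
space is separable. Neither closedness of `G` nor uniqueness of `g` is needed.

It remains to see that `L^p_Δ` is second countable. For `p < ∞` this holds over a σ-finite measure
on a countably generated σ-algebra. The `Δ`-measure is even finite: its point masses are the lengths
of the disjoint gaps of `T` in `[a, b]`. -/

/-- Each mass is the length of the gap from `t` to `sigma T t`. Distinct gaps are disjoint, and none
passes `b`, because `b` itself lies in `T`. -/
theorem tsum_graininess_le (T : Set ℝ) {a b : ℝ} (hb : b ∈ T) :
    ∑' t : {t : ℝ // t ∈ T ∩ Ico a b ∧ t < sigma T t}, ENNReal.ofReal (sigma T t.1 - t.1) ≤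
      volume (Icc a b) := by
  have hbdd : ∀ t, BddBelow (T ∩ Ioi t) := fun t => ⟨t, fun s hs => hs.2.le⟩
  have hle : ∀ {s t : ℝ}, s ∈ T → t < s → sigma T t ≤ s := fun {s t} hs hts => by
    have hne : (T ∩ Ioi t).Nonempty := ⟨s, hs, hts⟩
    rw [sigma, if_pos hne]
    exact csInf_le (hbdd t) ⟨hs, hts⟩
  have hdisj : Pairwise (Function.onFun Disjoint
      fun t : {t : ℝ // t ∈ T ∩ Ico a b ∧ t < sigma T t} => Ioo t.1 (sigma T t.1)) := by
    intro s t hst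
    rw [Function.onFun, Set.disjoint_left]
    intro x hx hy
    -- If two gaps shared a point, the larger left end point would lie in `T` strictly inside the
    -- gap of the smaller one.
    rcases lt_or_gt_of_ne (Subtype.coe_injective.ne hst) with h | h
    · exact absurd (hle t.2.1.1 h) (not_le.2 (hy.1.trans hx.2))
    · exact absurd (hle s.2.1.1 h) (not_le.2 (hx.1.trans hy.2))
  calc ∑' t : {t : ℝ // t ∈ T ∩ Ico a b ∧ t < sigma T t}, ENNReal.ofReal (sigma T t.1 - t.1)
      = ∑' t : {t : ℝ // t ∈ T ∩ Ico a b ∧ t < sigma T t}, volume (Ioo t.1 (sigma T t.1)) := by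
        simp only [Real.volume_Ioo]
    _ ≤ volume (⋃ t : {t : ℝ // t ∈ T ∩ Ico a b ∧ t < sigma T t}, Ioo t.1 (sigma T t.1)) :=
        -- This inequality holds for any index type, so countability of the right-scattered points
        -- need not be shown first.
        tsum_meas_le_meas_iUnion_of_disjoint _ (fun _ => measurableSet_Ioo) hdisj
    _ ≤ volume (Icc a b) := by
        refine measure_mono (iUnion_subset fun t x hx => ?_)
        exact ⟨t.2.1.2.1.trans hx.1.le, hx.2.le.trans (hle hb t.2.1.2.2)⟩

theorem isFiniteMeasure_deltaMeasure (T : Set ℝ) {a b : ℝ} (hb : b ∈ T) :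
    IsFiniteMeasure (deltaMeasure T a b) := by
  refine ⟨?_⟩
  rw [deltaMeasure, Measure.add_apply, ENNReal.add_lt_top]
  constructor
  · rw [Measure.restrict_apply_univ]
    exact (measure_mono inter_subset_right).trans_lt (by simp [Real.volume_Ico])
  · rw [Measure.sum_apply _ MeasurableSet.univ]
    simp only [Measure.smul_apply, measure_univ, smul_eq_mul, mul_one]
    exact (tsum_graininess_le T hb).trans_lt (by simp [Real.volume_Icc])

/-- The graph, with the `p`-norm of the product, maps onto the domain without increasing norms, so
the domain inherits separability. -/
theorem Domain.separableSpace {X : Type*} [NormedAddCommGroup X] [NormedSpace ℝ X]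
    [SecondCountableTopology X] {p : ℝ≥0∞} [Fact (1 ≤ p)] (G : Submodule ℝ (X × X)) :
    TopologicalSpace.SeparableSpace (Domain p G) := by
  -- Second countability, unlike separability, passes to arbitrary subspaces, here to the graph `S`.
  have : SecondCountableTopology (WithLp p (X × X)) :=
    (WithLp.prodContinuousLinearEquiv p ℝ X X).toHomeomorph.secondCountableTopology
  let S : Set (WithLp p (X × X)) := {x | WithLp.ofLp x ∈ G}
  let π : S → Domain p G := fun x => ⟨(WithLp.ofLp x.1).1, WithLp.ofLp x.1, x.2, rfl⟩
  have hlip : LipschitzWith 1 π := by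
    refine LipschitzWith.of_dist_le_mul fun x y => ?_
    rw [NNReal.coe_one, one_mul, dist_eq_norm, Subtype.dist_eq, dist_eq_norm]
    -- The difference of the two chosen derivatives is one competitor in the infimum defining the
    -- norm of `π x - π y`.
    exact Domain.graphNorm_le (π x - π y) (G.sub_mem x.2 y.2)
  have hsurj : Function.Surjective π := by
    rintro ⟨u, x, hx, rfl⟩
    exact ⟨⟨WithLp.toLp p x, hx⟩, rfl⟩
  exact hsurj.denseRange.separableSpace hlip.continuous

end TimeScale

theorem mainTheorem6 (T : Set ℝ) (hT : IsClosed T) (a b : ℝ) (ha : a ∈ T) (hb : b ∈ T)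
    (hab : a < b) (N : ℕ) (α : ℝ) (hα : 0 < α) (hα1 : α ≤ 1)
    (p : ℝ≥0∞) [Fact (1 ≤ p)] (hp : p ≠ ∞) :
    TopologicalSpace.SeparableSpace (TimeScale.RightSobolev T a b N α p) ∧
      TopologicalSpace.SeparableSpace (TimeScale.RightSobolevRL T a b N α p) := by
  have := TimeScale.isFiniteMeasure_deltaMeasure T (a := a) hb
  -- Together with finiteness of the measure, this lets instance search find that `L^p_Δ` is second
  -- countable.
  have : Fact (p ≠ ∞) := ⟨hp⟩
  exact ⟨TimeScale.Domain.separableSpace _, TimeScale.Domain.separableSpace _⟩
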